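/- Let $A$ and $X$ be sets and let $R \subseteq A \times X$ be a relation. Let $D_A$ be the abstract simplicial complex whose simplices are the nonempty finite subsets $\sigma_A \subseteq A$ for which there is some $x \in X$ with $(a,x) \in R$ for all $a \in \sigma_A$. Symmetrically, let $D_X$ be the complex whose simplices are the nonempty finite subsets $\sigma_X \subseteq X$ for which there is some $a \in A$ with $(a,x) \in R$ for all $x \in \sigma_X$. Say that $\sigma_A \in D_A$ and $\sigma_X \in D_X$ are related, written $\sigma_A \tilde{R} \sigma_X$, if $(a,x) \in R$ for all $a \in \sigma_A$ and all $x \in \sigma_X$. The Dowker join complex is the abstract simplicial complex on the disjoint union of $A$ and $X$ \[ D_A \star_{\tilde{R}} D_X = D_A \cup D_X \cup \{\sigma_A \cup \sigma_X \mid \sigma_A \in D_A,\ \sigma_X \in D_X,\ \sigma_A \tilde{R} \sigma_X\}. \] Then the geometric realizations of these complexes (with the weak topology) are homotopy equivalent: \[ D_A \simeq D_A \star_{\tilde{R}} D_X \simeq D_X. \] -/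

import Mathlib

universe u v

/-- A point of the geometric realization of an abstract simplicial complex `K`, given by its
barycentric coordinates: nonnegative weights on the vertices which sum to `1` and whose support
is a simplex of `K`. -/
structure GeomRealization {V : Type u} (K : PreAbstractSimplicialComplex V) where
  /-- the barycentric coordinates -/
  coord : V →₀ ℝ
  nonneg : ∀ v, 0 ≤ coord v
  sum_eq_one : coord.sum (fun _ t => t) = 1
  support_mem : coord.support ∈ K.faces

namespace GeomRealization

variable {V : Type u} {K : PreAbstractSimplicialComplex V}

/-- The closed geometric simplex of `K` spanned by a finite set of vertices `σ`. -/
def Cell (K : PreAbstractSimplicialComplex V) (σ : Finset V) : Type u :=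
  {p : GeomRealization K // p.coord.support ⊆ σ}

/-- A closed simplex carries its Euclidean topology: the topology of convergence of each of the
(finitely many nonzero) barycentric coordinates. -/
instance (σ : Finset V) : TopologicalSpace (Cell K σ) :=
  TopologicalSpace.induced (fun p : Cell K σ => (fun v => p.1.coord v : V → ℝ)) inferInstance

/-- The weak (coherent) topology: a set is open if and only if its intersection with
every closed simplex is open in that simplex. -/
instance : TopologicalSpace (GeomRealization K) :=
  ⨆ σ : K.faces, TopologicalSpace.coinduced (fun p : Cell K σ.1 => p.1) inferInstance

end GeomRealization

/-- The Dowker complex with base `A` of a relation `R ⊆ A × X`: its simplices are the nonempty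
finite subsets of `A` all of whose elements are related to a common element of `X`.
The Dowker complex with base `X` is `dowkerComplex R.inv`. -/
def dowkerComplex {A : Type u} {X : Type v} (R : SetRel A X) : PreAbstractSimplicialComplex A where
  faces := {σ | σ.Nonempty ∧ ∃ x : X, ∀ a ∈ σ, (a, x) ∈ R}
  isRelLowerSet_faces := by
    rintro σ ⟨hne, x, hx⟩
    exact ⟨hne, fun τ hτ hτne => ⟨hτne, x, fun a ha => hx a (hτ ha)⟩⟩

/-- The relational join complex `K ∪ M ∪ {σ ∪ τ | σ ∈ K, τ ∈ M, σ S τ}` of two simplicial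
complexes along a relation `S` between their simplices. The vertex sets are made disjoint by
passing to the disjoint union `V ⊕ W`. The relation has to be inherited by faces in order for
this to be a simplicial complex. -/
def relationalJoin {V : Type u} {W : Type v} (K : PreAbstractSimplicialComplex V)
    (M : PreAbstractSimplicialComplex W) (S : SetRel (Finset V) (Finset W))
    (hS : ∀ σ ∈ K.faces, ∀ τ ∈ M.faces, (σ, τ) ∈ S →
      ∀ σ' ⊆ σ, ∀ τ' ⊆ τ, σ'.Nonempty → τ'.Nonempty → (σ', τ') ∈ S) :
    PreAbstractSimplicialComplex (V ⊕ W) where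
  faces := {s | ∃ σ ∈ K.faces, s = σ.map Function.Embedding.inl} ∪
    {s | ∃ τ ∈ M.faces, s = τ.map Function.Embedding.inr} ∪
    {s | ∃ σ ∈ K.faces, ∃ τ ∈ M.faces, (σ, τ) ∈ S ∧
      s = σ.disjSum τ}
  isRelLowerSet_faces := by
    have key : ∀ s : Finset (V ⊕ W), s.Nonempty → (s.toLeft.Nonempty → s.toLeft ∈ K.faces) →
        (s.toRight.Nonempty → s.toRight ∈ M.faces) →
        (s.toLeft.Nonempty → s.toRight.Nonempty → (s.toLeft, s.toRight) ∈ S) →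
        s ∈ {s | ∃ σ ∈ K.faces, s = σ.map Function.Embedding.inl} ∪
          {s | ∃ τ ∈ M.faces, s = τ.map Function.Embedding.inr} ∪
          {s | ∃ σ ∈ K.faces, ∃ τ ∈ M.faces, (σ, τ) ∈ S ∧ s = σ.disjSum τ} := by
      intro s hs hl hr hlr
      have e : s = s.toLeft.disjSum s.toRight := Finset.toLeft_disjSum_toRight.symm
      by_cases h1 : s.toLeft.Nonempty <;> by_cases h2 : s.toRight.Nonempty
      · exact Or.inr ⟨_, hl h1, _, hr h2, hlr h1 h2, e⟩
      · rw [Finset.not_nonempty_iff_eq_empty] at h2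
        exact Or.inl (Or.inl ⟨_, hl h1, by rw [h2, Finset.disjSum_empty] at e; exact e⟩)
      · rw [Finset.not_nonempty_iff_eq_empty] at h1
        exact Or.inl (Or.inr ⟨_, hr h2, by rw [h1, Finset.empty_disjSum] at e; exact e⟩)
      · rw [Finset.not_nonempty_iff_eq_empty] at h1 h2
        rw [h1, h2] at e
        simp [e] at hs
    rintro s ((⟨σ, hσ, rfl⟩ | ⟨τ, hτ, rfl⟩) | ⟨σ, hσ, τ, hτ, h, rfl⟩)
    · have hK := K.isRelLowerSet_faces hσ
      refine ⟨hK.1.map, fun t ht hne => ?_⟩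
      have hl : t.toLeft ⊆ σ := fun a ha => by simpa using ht (Finset.mem_toLeft.1 ha)
      have hr : ¬ t.toRight.Nonempty := fun ⟨x, hx⟩ => by
        simpa using ht (Finset.mem_toRight.1 hx)
      exact key t hne (fun h => hK.2 hl h) (fun h => (hr h).elim) (fun _ h => (hr h).elim)
    · have hM := M.isRelLowerSet_faces hτ
      refine ⟨hM.1.map, fun t ht hne => ?_⟩
      have hr : t.toRight ⊆ τ := fun a ha => by simpa using ht (Finset.mem_toRight.1 ha)
      have hl : ¬ t.toLeft.Nonempty := fun ⟨x, hx⟩ => by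
        simpa using ht (Finset.mem_toLeft.1 hx)
      exact key t hne (fun h => (hl h).elim) (fun h => hM.2 hr h) (fun h => (hl h).elim)
    · have hK := K.isRelLowerSet_faces hσ
      have hM := M.isRelLowerSet_faces hτ
      refine ⟨?_, fun t ht hne => ?_⟩
      · obtain ⟨a, ha⟩ := hK.1
        exact ⟨Sum.inl a, by simpa using ha⟩
      have hl : t.toLeft ⊆ σ := fun a ha => by simpa using ht (Finset.mem_toLeft.1 ha)
      have hr : t.toRight ⊆ τ := fun a ha => by simpa using ht (Finset.mem_toRight.1 ha)
      exact key t hne (fun h => hK.2 hl h) (fun h => hM.2 hr h)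
        (fun h1 h2 => hS σ hσ τ hτ h _ hl _ hr h1 h2)

/-- The relation between simplices induced by a relation `R ⊆ A × X` between vertices:
`σ` is related to `τ` if every element of `σ` is related to every element of `τ`. -/
def inducedRel {A : Type u} {X : Type v} (R : SetRel A X) : SetRel (Finset A) (Finset X) :=
  {p | ∀ a ∈ p.1, ∀ x ∈ p.2, (a, x) ∈ R}

/-- The Dowker join complex of a relation `R ⊆ A × X`. -/
def dowkerJoin {A : Type u} {X : Type v} (R : SetRel A X) :
    PreAbstractSimplicialComplex (A ⊕ X) :=
  relationalJoin (dowkerComplex R) (dowkerComplex R.inv) (inducedRel R)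
    (fun _ _ _ _ h _ hσ _ hτ _ _ a ha x hx => h a (hσ ha) x (hτ hx))

/-! By symmetry it suffices to show that the inclusion `i` of the realization of `D_A` into that of
the join is a homotopy equivalence. A retraction `r` has to move the weight on right vertices to
left ones. Pick for each simplex `ρ` of `D_X` a vertex `a ρ` related to all of `ρ`, and let `r` add
to the left coordinates of `p` a weight at `a ρ` for each `ρ` in the support of `p`. Arbitrary
vertices `a ρ` need not span a simplex, so only those `ρ` may count that contain every right vertex
with coordinate above a threshold. The threshold depends continuously on `p` and is below the
largest right coordinate (`exists_threshold_lt`), so some `x` lies in all these `ρ` and is related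
to every vertex of `r p`.

More precisely, every vertex of `r p` is related to every right vertex above the threshold
(`mem_of_leftWeights_ne_zero`). Let `t` cut the right coordinates off at the threshold. Then `i (r
p)` and `t p` lie in a common simplex, and so do `t p` and `p`; straight lines give `i ∘ r ≃ t ≃
id`, while `r ∘ i = id` holds exactly. -/

namespace GeomRealization

/-! ### Weak topology, normalized weights and straight-line homotopies. -/

section Basic

variable {V : Type u} {W : Type v} {K : PreAbstractSimplicialComplex V}
  {L : PreAbstractSimplicialComplex W}

@[ext]
theorem ext {p q : GeomRealization K} (h : ∀ v, p.coord v = q.coord v) : p = q := by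
  have h' : p.coord = q.coord := Finsupp.ext h
  cases p
  cases q
  cases h'
  rfl

theorem continuous_cell_coord (σ : Finset V) (v : V) :
    Continuous fun p : Cell K σ => p.1.coord v :=
  (continuous_apply v).comp continuous_induced_dom

/-- A point supported in `σ`, as a point of the closed simplex spanned by `σ`. -/
def toCell {σ : Finset V} (p : GeomRealization K) (h : p.coord.support ⊆ σ) : Cell K σ :=
  ⟨p, h⟩

theorem continuous_toCell {Y : Type*} [TopologicalSpace Y] {σ : Finset V}
    {f : Y → GeomRealization K} (hσ : ∀ y, (f y).coord.support ⊆ σ)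
    (hf : ∀ v, Continuous fun y => (f y).coord v) : Continuous fun y => toCell (f y) (hσ y) :=
  continuous_induced_rng.2 (continuous_pi hf)

theorem isClosed_setOf_support_subset (B σ : Finset V) :
    IsClosed {p : Cell K B | p.1.coord.support ⊆ σ} := by
  have h : {p : Cell K B | p.1.coord.support ⊆ σ} =
      ⋂ v ∈ {v | v ∉ σ}, {p : Cell K B | p.1.coord v = 0} := by
    ext p
    simp only [Set.mem_ofPred_eq, Set.mem_iInter, Finset.subset_iff, Finsupp.mem_support_iff]
    exact forall_congr' fun v => not_imp_comm
  rw [h]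
  exact isClosed_biInter fun v _ => isClosed_eq (continuous_cell_coord B v) continuous_const

/-- The points supported in a finite vertex set `B`, which need not be a simplex, form a finite
union of closed simplices, so their coordinate topology is compatible with the weak topology. -/
theorem continuous_cell_val (B : Finset V) : Continuous fun p : Cell K B => p.1 := by
  let ι := {σ : Finset V // σ ∈ B.powerset ∧ σ ∈ K.faces}
  have : Finite ι := (B.powerset.finite_toSet.subset fun σ h => h.1 : Set.Finite
    {σ : Finset V | σ ∈ B.powerset ∧ σ ∈ K.faces}).to_subtype
  refine LocallyFinite.continuous (f := fun σ : ι => {p : Cell K B | p.1.coord.support ⊆ σ.1})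
    (locallyFinite_of_finite _) ?_ (fun σ => isClosed_setOf_support_subset B σ.1) fun σ => ?_
  · refine Set.eq_univ_of_forall fun p => Set.mem_iUnion.2
      ⟨⟨p.1.coord.support, Finset.mem_powerset.2 p.2, p.1.support_mem⟩,
        Finset.Subset.refl p.1.coord.support⟩
  · rw [continuousOn_iff_continuous_domRestrict]
    have h₁ : Continuous fun p : Cell K σ.1 => p.1 :=
      continuous_iSup_rng (i := (⟨σ.1, σ.2.2⟩ : K.faces)) continuous_coinduced_rng
    have h₂ : Continuous fun p : {p : Cell K B | p.1.coord.support ⊆ σ.1} =>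
        toCell p.1.1 p.2 :=
      continuous_toCell _ fun v => (continuous_cell_coord B v).comp continuous_subtype_val
    exact h₁.comp h₂

theorem continuous_of_coord {Y : Type*} [TopologicalSpace Y] {f : Y → GeomRealization K}
    (B : Finset V) (hB : ∀ y, (f y).coord.support ⊆ B)
    (hf : ∀ v, Continuous fun y => (f y).coord v) : Continuous f := by
  exact (continuous_cell_val B).comp (continuous_toCell hB hf)

theorem continuous_dom {Y : Type*} [TopologicalSpace Y] {f : GeomRealization K → Y}
    (hf : ∀ σ : Finset V, Continuous fun p : Cell K σ => f p.1) : Continuous f :=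
  continuous_iSup_dom.2 fun σ => continuous_coinduced_dom.2 (hf σ.1)

/-- The product with a locally compact space preserves the coherent topology: curry, test continuity
into `C(Y, Z)` on cells, and uncurry. It is applied to the unit interval. -/
theorem continuous_prod_dom {Y Z : Type*} [TopologicalSpace Y] [LocallyCompactSpace Y]
    [TopologicalSpace Z] {f : Y × GeomRealization K → Z}
    (hf : ∀ σ : Finset V, Continuous fun q : Y × Cell K σ => f (q.1, q.2.1)) :
    Continuous f := by
  have hp (p : GeomRealization K) : Continuous fun y => f (y, p) :=
    (hf p.coord.support).comp (continuous_id.prodMk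
      (continuous_const (y := toCell p (Finset.Subset.refl _))))
  let g : GeomRealization K → C(Y, Z) := fun p => ⟨fun y => f (y, p), hp p⟩
  have hg : Continuous g := continuous_dom fun σ =>
    ContinuousMap.continuous_of_continuous_uncurry _ ((hf σ).comp continuous_swap)
  have h : Continuous fun q : GeomRealization K × Y => g q.1 q.2 :=
    ContinuousMap.continuous_uncurry_of_continuous ⟨g, hg⟩
  exact h.comp continuous_swap

theorem sum_pos_of_support_mem {w : V →₀ ℝ} (h0 : ∀ v, 0 ≤ w v) (hw : w.support ∈ K.faces) :
    0 < w.sum fun _ t => t :=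
  Finset.sum_pos (fun v hv => (h0 v).lt_of_ne' (Finsupp.mem_support_iff.1 hv))
    (K.isRelLowerSet_faces hw).1

/-- The point with barycentric coordinates proportional to the weights `w`. -/
noncomputable def ofWeights (K : PreAbstractSimplicialComplex V) (w : V →₀ ℝ)
    (h0 : ∀ v, 0 ≤ w v) (hw : w.support ∈ K.faces) : GeomRealization K where
  coord := (w.sum fun _ t => t)⁻¹ • w
  nonneg v := by
    have := (sum_pos_of_support_mem h0 hw).le
    have := h0 v
    simp only [Finsupp.smul_apply, smul_eq_mul]
    positivity
  sum_eq_one := by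
    have h := (sum_pos_of_support_mem h0 hw).ne'
    rw [Finsupp.sum_smul_index fun _ => rfl, ← Finsupp.mul_sum, inv_mul_cancel₀ h]
  support_mem := by
    have h := (sum_pos_of_support_mem h0 hw).ne'
    rwa [Finsupp.support_smul_eq (inv_ne_zero h)]

theorem support_ofWeights {w : V →₀ ℝ} (h0 : ∀ v, 0 ≤ w v) (hw : w.support ∈ K.faces) :
    (ofWeights K w h0 hw).coord.support = w.support :=
  Finsupp.support_smul_eq (inv_ne_zero (sum_pos_of_support_mem h0 hw).ne')

theorem ofWeights_eq {w : V →₀ ℝ} (h0 : ∀ v, 0 ≤ w v) (hw : w.support ∈ K.faces)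
    {p : GeomRealization K} (h : w = p.coord) : ofWeights K w h0 hw = p := by
  subst h
  ext v
  simp [ofWeights, p.sum_eq_one]

theorem continuous_coord_ofWeights {Y : Type*} [TopologicalSpace Y] {w : Y → V →₀ ℝ}
    (h0 : ∀ y v, 0 ≤ w y v) (hw : ∀ y, (w y).support ∈ K.faces) (B : Finset V)
    (hB : ∀ y, (w y).support ⊆ B) (hc : ∀ v, Continuous fun y => w y v) (v : V) :
    Continuous fun y => (ofWeights K (w y) (h0 y) (hw y)).coord v := by
  have hs : Continuous fun y => (w y).sum fun _ t => t := by
    have : (fun y => (w y).sum fun _ t => t) = fun y => ∑ v ∈ B, w y v :=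
      funext fun y => Finsupp.sum_of_support_subset _ (hB y) _ fun _ _ => rfl
    rw [this]
    exact continuous_finsetSum _ fun v _ => hc v
  exact (hs.inv₀ fun y => (sum_pos_of_support_mem (h0 y) (hw y)).ne').mul (hc v)

/-- A map into finitely supported functions that, on the points supported in a finite
vertex set, takes values with support in a finite set and has continuous coordinates. -/
def FinitaryContinuous (F : GeomRealization K → W →₀ ℝ) : Prop :=
  ∀ σ : Finset V, (∃ B : Finset W, ∀ p : Cell K σ, (F p.1).support ⊆ B) ∧
    ∀ w, Continuous fun p : Cell K σ => F p.1 w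

theorem FinitaryContinuous.coord : FinitaryContinuous fun p : GeomRealization K => p.coord :=
  fun σ => ⟨⟨σ, fun p => p.2⟩, continuous_cell_coord σ⟩

/-- The finite set `B` containing the supports of the images of one cell need not be a simplex; this
is why finitary continuity quantifies over all finite vertex sets. -/
theorem FinitaryContinuous.comp {U : Type*} {F : GeomRealization L → U →₀ ℝ}
    {g : GeomRealization K → GeomRealization L} (hF : FinitaryContinuous F)
    (hg : FinitaryContinuous fun p => (g p).coord) : FinitaryContinuous fun p => F (g p) := by
  intro σ
  obtain ⟨⟨B, hB⟩, hc⟩ := hg σ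
  obtain ⟨⟨C, hC⟩, hd⟩ := hF B
  exact ⟨⟨C, fun p => hC (toCell (g p.1) (hB p))⟩,
    fun w => (hd w).comp (continuous_toCell hB hc)⟩

theorem FinitaryContinuous.ofWeights {F : GeomRealization K → W →₀ ℝ}
    (hF : FinitaryContinuous F) (h0 : ∀ p w, 0 ≤ F p w) (hs : ∀ p, (F p).support ∈ L.faces) :
    FinitaryContinuous fun p => (ofWeights L (F p) (h0 p) (hs p)).coord := by
  intro σ
  obtain ⟨⟨B, hB⟩, hc⟩ := hF σ
  exact ⟨⟨B, fun p => (support_ofWeights (h0 p.1) (hs p.1)).symm ▸ hB p⟩,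
    continuous_coord_ofWeights (fun p : Cell K σ => h0 p.1) (fun p => hs p.1) B hB hc⟩

theorem FinitaryContinuous.continuous {f : GeomRealization K → GeomRealization L}
    (hf : FinitaryContinuous fun p => (f p).coord) : Continuous f :=
  continuous_dom fun σ => by
    obtain ⟨⟨B, hB⟩, hc⟩ := hf σ
    exact continuous_of_coord B hB hc

/-- Two maps are homotopic along straight lines if the images of each point lie in a common
simplex. -/
theorem homotopic_of_support_union_mem [DecidableEq W]
    {f g : C(GeomRealization K, GeomRealization L)}
    (hf : FinitaryContinuous fun p => (f p).coord) (hg : FinitaryContinuous fun p => (g p).coord)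
    (h : ∀ p, (f p).coord.support ∪ (g p).coord.support ∈ L.faces) : f.Homotopic g := by
  let w : unitInterval × GeomRealization K → W →₀ ℝ := fun q =>
    (1 - (q.1 : ℝ)) • (f q.2).coord + (q.1 : ℝ) • (g q.2).coord
  have h0 (q) (v) : 0 ≤ w q v := by
    have h₁ := q.1.2.1
    have h₂ := sub_nonneg.2 q.1.2.2
    have h₃ := (f q.2).nonneg v
    have h₄ := (g q.2).nonneg v
    simp only [w, Finsupp.add_apply, Finsupp.smul_apply, smul_eq_mul]
    positivity
  have hsub (q) : (w q).support ⊆ (f q.2).coord.support ∪ (g q.2).coord.support :=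
    Finsupp.support_add.trans
      (Finset.union_subset_union Finsupp.support_smul Finsupp.support_smul)
  -- This keeps the support nonempty below. The normalization in `ofWeights` thus changes nothing
  -- and serves only to reuse its continuity.
  have hsum (q) : ((w q).sum fun _ t => t) = 1 := by
    rw [Finsupp.sum_add_index' (fun _ => rfl) (fun _ _ _ => rfl),
      Finsupp.sum_smul_index fun _ => rfl, Finsupp.sum_smul_index fun _ => rfl,
      ← Finsupp.mul_sum, ← Finsupp.mul_sum, (f q.2).sum_eq_one, (g q.2).sum_eq_one]
    ring
  have hs (q) : (w q).support ∈ L.faces := by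
    refine (L.isRelLowerSet_faces (h q.2)).2 (hsub q) ?_
    rw [Finset.nonempty_iff_ne_empty]
    intro he
    have := hsum q
    simp [Finsupp.sum, he] at this
  refine ⟨⟨⟨fun q => ofWeights L (w q) (h0 q) (hs q), ?_⟩, fun p => ?_, fun p => ?_⟩⟩
  · refine continuous_prod_dom fun σ => ?_
    obtain ⟨⟨B, hB⟩, hc⟩ := hf σ
    obtain ⟨⟨C, hC⟩, hd⟩ := hg σ
    have hBC (q : unitInterval × Cell K σ) : (w (q.1, q.2.1)).support ⊆ B ∪ C :=
      (hsub _).trans (Finset.union_subset_union (hB q.2) (hC q.2))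
    refine continuous_of_coord (B ∪ C) (fun q => ?_) (continuous_coord_ofWeights _ _ (B ∪ C) hBC
      fun v => ?_)
    · rw [support_ofWeights]
      exact hBC q
    · have h₁ : Continuous fun q : unitInterval × Cell K σ => (q.1 : ℝ) :=
        continuous_subtype_val.comp continuous_fst
      exact ((continuous_const.sub h₁).mul ((hc v).comp continuous_snd)).add
        (h₁.mul ((hd v).comp continuous_snd))
  · exact ofWeights_eq (h0 _) (hs _) (by simp [w])
  · exact ofWeights_eq (h0 _) (hs _) (by simp [w])

/-- The map of realizations induced by an injective simplicial map. -/
noncomputable def mapEmb (e : V ↪ W) (he : ∀ σ ∈ K.faces, σ.map e ∈ L.faces)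
    (p : GeomRealization K) : GeomRealization L where
  coord := p.coord.embDomain e
  nonneg w := by
    by_cases hw : w ∈ Set.range e
    · obtain ⟨v, rfl⟩ := hw
      rw [Finsupp.embDomain_apply_self]
      exact p.nonneg v
    · rw [Finsupp.embDomain_of_notMem_range _ _ _ hw]
  sum_eq_one := by
    simpa only [Finsupp.sum, Finsupp.support_embDomain, Finset.sum_map,
      Finsupp.embDomain_apply_self] using p.sum_eq_one
  support_mem := by
    rw [Finsupp.support_embDomain]
    exact he _ p.support_mem

theorem FinitaryContinuous.mapEmb (e : V ↪ W) (he : ∀ σ ∈ K.faces, σ.map e ∈ L.faces) :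
    FinitaryContinuous fun p => (mapEmb e he p).coord := by
  refine fun σ => ⟨⟨σ.map e, fun p => ?_⟩, fun w => ?_⟩
  · simpa only [GeomRealization.mapEmb, Finsupp.support_embDomain, Finset.map_subset_map] using p.2
  · by_cases hw : w ∈ Set.range e
    · obtain ⟨v, rfl⟩ := hw
      simpa only [GeomRealization.mapEmb, Finsupp.embDomain_apply_self] using
        continuous_cell_coord σ v
    · simpa only [GeomRealization.mapEmb, Finsupp.embDomain_of_notMem_range _ _ _ hw] using
        continuous_const

/-- An isomorphism of simplicial complexes induces a homeomorphism of realizations. -/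
noncomputable def homeomorphOfEquiv (e : V ≃ W) (he : ∀ σ ∈ K.faces, σ.map e.toEmbedding ∈ L.faces)
    (he' : ∀ σ ∈ L.faces, σ.map e.symm.toEmbedding ∈ K.faces) :
    GeomRealization K ≃ₜ GeomRealization L where
  toFun := mapEmb e.toEmbedding he
  invFun := mapEmb e.symm.toEmbedding he'
  left_inv p := by
    ext v
    have h := Finsupp.embDomain_apply_self e.symm.toEmbedding
      (p.coord.embDomain e.toEmbedding) (e v)
    have h' := Finsupp.embDomain_apply_self e.toEmbedding p.coord v
    simp only [Equiv.toEmbedding_apply, Equiv.symm_apply_apply] at h h'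
    exact h.trans h'
  right_inv p := by
    ext v
    have h := Finsupp.embDomain_apply_self e.toEmbedding
      (p.coord.embDomain e.symm.toEmbedding) (e.symm v)
    have h' := Finsupp.embDomain_apply_self e.symm.toEmbedding p.coord v
    simp only [Equiv.toEmbedding_apply, Equiv.apply_symm_apply] at h h'
    exact h.trans h'
  continuous_toFun := (FinitaryContinuous.mapEmb _ he).continuous
  continuous_invFun := (FinitaryContinuous.mapEmb _ he').continuous

end Basic

/-! ### Simplices of the Dowker join. -/

/-- A description symmetric in both sides that merges the three kinds of simplices. The existential
clauses matter for one-sided simplices; if both sides are inhabited, the first clause implies them.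
-/
theorem mem_faces_dowkerJoin {A : Type u} {X : Type v} {R : SetRel A X} {s : Finset (A ⊕ X)} :
    s ∈ (dowkerJoin R).faces ↔ s.Nonempty ∧
      (∀ a x, Sum.inl a ∈ s → Sum.inr x ∈ s → (a, x) ∈ R) ∧
      (∃ x, ∀ a, Sum.inl a ∈ s → (a, x) ∈ R) ∧ ∃ a, ∀ x, Sum.inr x ∈ s → (a, x) ∈ R := by
  constructor
  · intro hs
    refine ⟨((dowkerJoin R).isRelLowerSet_faces hs).1, ?_⟩
    rcases hs with (⟨σ, ⟨⟨a, ha⟩, x, hx⟩, rfl⟩ | ⟨τ, ⟨⟨x, hx⟩, a, ha⟩, rfl⟩) |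
      ⟨σ, ⟨-, x, hx⟩, τ, ⟨-, a, ha⟩, h, rfl⟩
    · exact ⟨by simp, ⟨x, by simpa using hx⟩, a, by simp⟩
    · exact ⟨by simp, ⟨x, by simp⟩, a, by simpa using ha⟩
    · refine ⟨fun a x ha hx => h a (by simpa using ha) x (by simpa using hx),
        ⟨x, by simpa using hx⟩, a, by simpa using ha⟩
  · rintro ⟨hne, h, ⟨x, hx⟩, a, ha⟩
    have e : s = s.toLeft.disjSum s.toRight := Finset.toLeft_disjSum_toRight.symm
    have hl (h1 : s.toLeft.Nonempty) : s.toLeft ∈ (dowkerComplex R).faces :=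
      ⟨h1, x, fun a ha => hx a (Finset.mem_toLeft.1 ha)⟩
    have hr (h2 : s.toRight.Nonempty) : s.toRight ∈ (dowkerComplex R.inv).faces :=
      ⟨h2, a, fun x hx => ha x (Finset.mem_toRight.1 hx)⟩
    by_cases h1 : s.toLeft.Nonempty <;> by_cases h2 : s.toRight.Nonempty
    · exact Or.inr ⟨_, hl h1, _, hr h2,
        fun a ha x hx => h a x (Finset.mem_toLeft.1 ha) (Finset.mem_toRight.1 hx), e⟩
    · rw [Finset.not_nonempty_iff_eq_empty] at h2
      exact Or.inl (Or.inl ⟨_, hl h1, by rwa [h2, Finset.disjSum_empty] at e⟩)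
    · rw [Finset.not_nonempty_iff_eq_empty] at h1
      exact Or.inl (Or.inr ⟨_, hr h2, by rwa [h1, Finset.empty_disjSum] at e⟩)
    · rw [Finset.not_nonempty_iff_eq_empty] at h1 h2
      rw [h1, h2] at e
      simp [e] at hne

/-! ### Threshold, subset weights and the weights of `r` and `t`. -/

section Retraction

variable {A : Type u} {X : Type v} {K : PreAbstractSimplicialComplex (A ⊕ X)}

/-- Half the sum of the squares of the right coordinates: a continuous function which lies strictly
below the maximal right coordinate, if there is a positive one. -/
noncomputable def threshold (p : GeomRealization K) : ℝ :=
  (∑ x ∈ p.coord.support.toRight, p.coord (Sum.inr x) ^ 2) / 2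

open Classical in
/-- The weight of a set `ρ` of right vertices: it is positive only if `ρ` is contained in the
support of `p` and contains all vertices whose coordinate exceeds the threshold. -/
noncomputable def subsetWeight (p : GeomRealization K) (ρ : Finset X) : ℝ :=
  (∏ x ∈ ρ, p.coord (Sum.inr x)) *
    max 0 (threshold p - ∑ x ∈ p.coord.support.toRight \ ρ, p.coord (Sum.inr x))

theorem threshold_nonneg (p : GeomRealization K) : 0 ≤ threshold p :=
  div_nonneg (Finset.sum_nonneg fun _ _ => sq_nonneg _) zero_le_two

theorem sum_right_le_one (p : GeomRealization K) :
    ∑ x ∈ p.coord.support.toRight, p.coord (Sum.inr x) ≤ 1 := by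
  classical
  calc ∑ x ∈ p.coord.support.toRight, p.coord (Sum.inr x)
      = ∑ v ∈ p.coord.support.toRight.map Function.Embedding.inr, p.coord v :=
        (Finset.sum_map _ Function.Embedding.inr p.coord).symm
    _ ≤ ∑ v ∈ p.coord.support, p.coord v := by
        refine Finset.sum_le_sum_of_subset_of_nonneg (fun v hv => ?_) fun v _ _ => p.nonneg v
        obtain ⟨x, hx, rfl⟩ := Finset.mem_map.1 hv
        exact Finset.mem_toRight.1 hx
    _ = 1 := p.sum_eq_one

theorem pos_of_mem_toRight {p : GeomRealization K} {x : X} (hx : x ∈ p.coord.support.toRight) :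
    0 < p.coord (Sum.inr x) :=
  (p.nonneg _).lt_of_ne' (Finsupp.mem_support_iff.1 (Finset.mem_toRight.1 hx))

theorem threshold_pos {p : GeomRealization K} (h : p.coord.support.toRight.Nonempty) :
    0 < threshold p :=
  half_pos (Finset.sum_pos (fun _ hx => pow_pos (pos_of_mem_toRight hx) 2) h)

/-- The right coordinates sum to at most `1`, so the sum of their squares is at most the largest of
them; halving makes this strict. -/
theorem exists_threshold_lt {p : GeomRealization K} (h : p.coord.support.toRight.Nonempty) :
    ∃ x, threshold p < p.coord (Sum.inr x) := by
  by_contra! hc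
  have h1 : ∑ x ∈ p.coord.support.toRight, p.coord (Sum.inr x) ^ 2 ≤ threshold p * 1 := by
    calc ∑ x ∈ p.coord.support.toRight, p.coord (Sum.inr x) ^ 2
        ≤ ∑ x ∈ p.coord.support.toRight, threshold p * p.coord (Sum.inr x) :=
          Finset.sum_le_sum fun x _ => by
            rw [sq]
            exact mul_le_mul_of_nonneg_right (hc x) (p.nonneg _)
      _ ≤ threshold p * 1 := by
          rw [← Finset.mul_sum]
          exact mul_le_mul_of_nonneg_left (sum_right_le_one p) (threshold_nonneg p)
  have h2 := threshold_pos h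
  have h3 : threshold p = (∑ x ∈ p.coord.support.toRight, p.coord (Sum.inr x) ^ 2) / 2 := rfl
  linarith

theorem subsetWeight_nonneg (p : GeomRealization K) (ρ : Finset X) : 0 ≤ subsetWeight p ρ :=
  mul_nonneg (Finset.prod_nonneg fun _ _ => p.nonneg _) (le_max_left _ _)

theorem subset_of_subsetWeight_ne_zero {p : GeomRealization K} {ρ : Finset X}
    (h : subsetWeight p ρ ≠ 0) : ρ ⊆ p.coord.support.toRight := fun x hx =>
  Finset.mem_toRight.2 (Finsupp.mem_support_iff.2
    fun h0 => h (by rw [subsetWeight, Finset.prod_eq_zero hx h0, zero_mul]))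

/-- A vertex outside `ρ` with coordinate above the threshold already makes the sum over the
complement of `ρ` exceed it, which kills the second factor of the weight. -/
theorem mem_of_subsetWeight_ne_zero {p : GeomRealization K} {ρ : Finset X}
    (h : subsetWeight p ρ ≠ 0) {x : X} (hx : threshold p < p.coord (Sum.inr x)) : x ∈ ρ := by
  classical
  by_contra hρ
  have hpos := (threshold_nonneg p).trans_lt hx
  have hmem : x ∈ p.coord.support.toRight \ ρ :=
    Finset.mem_sdiff.2 ⟨Finset.mem_toRight.2 (Finsupp.mem_support_iff.2 hpos.ne'), hρ⟩
  have hle := Finset.single_le_sum (f := fun x => p.coord (Sum.inr x))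
    (fun x _ => p.nonneg _) hmem
  refine h ?_
  rw [subsetWeight, max_eq_left, mul_zero]
  linarith

theorem subsetWeight_support_pos {p : GeomRealization K}
    (h : p.coord.support.toRight.Nonempty) : 0 < subsetWeight p p.coord.support.toRight := by
  classical
  refine mul_pos (Finset.prod_pos fun x hx => pos_of_mem_toRight hx) ?_
  simpa using threshold_pos h

/-- The weights of the retraction to the left vertices which sends the weight of a set `ρ` of
right vertices to the vertex `a ρ`. -/
noncomputable def leftWeights (a : Finset X → A) (p : GeomRealization K) : A →₀ ℝ :=
  p.coord.comapDomain Sum.inl Sum.inl_injective.injOn +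
    ∑ ρ ∈ p.coord.support.toRight.powerset, Finsupp.single (a ρ) (subsetWeight p ρ)

/-- The weights which move a point into the simplex spanned by its left vertices and those right
vertices whose coordinate exceeds the threshold. -/
noncomputable def truncatedWeights (p : GeomRealization K) : A ⊕ X →₀ ℝ :=
  Finsupp.onFinset p.coord.support
    (Sum.elim (fun a => p.coord (Sum.inl a)) fun x => max 0 (p.coord (Sum.inr x) - threshold p))
    (by
      rintro (a | x) h
      · exact Finsupp.mem_support_iff.2 h
      · refine Finsupp.mem_support_iff.2 fun h0 => h ?_
        have := threshold_nonneg p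
        simp [h0, this])

section Continuity

variable {σ : Finset (A ⊕ X)}

theorem toRight_support_subset (p : Cell K σ) : p.1.coord.support.toRight ⊆ σ.toRight :=
  fun _ hx => Finset.mem_toRight.2 (p.2 (Finset.mem_toRight.1 hx))

/-- An index set independent of `p` makes continuity on the cell visible. -/
theorem threshold_cell (p : Cell K σ) :
    threshold p.1 = (∑ x ∈ σ.toRight, p.1.coord (Sum.inr x) ^ 2) / 2 := by
  rw [threshold, Finset.sum_subset (toRight_support_subset p)]
  intro x _ hx
  rw [Finset.mem_toRight, Finsupp.notMem_support_iff] at hx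
  simp [hx]

theorem continuous_threshold_cell : Continuous fun p : Cell K σ => threshold p.1 := by
  simp only [threshold_cell]
  exact (continuous_finsetSum _ fun x _ => (continuous_cell_coord σ _).pow 2).div_const 2

theorem continuous_subsetWeight_cell (ρ : Finset X) :
    Continuous fun p : Cell K σ => subsetWeight p.1 ρ := by
  classical
  have h (p : Cell K σ) : subsetWeight p.1 ρ = (∏ x ∈ ρ, p.1.coord (Sum.inr x)) *
      max 0 (threshold p.1 - ∑ x ∈ σ.toRight \ ρ, p.1.coord (Sum.inr x)) := by
    have hs : ∑ x ∈ p.1.coord.support.toRight \ ρ, p.1.coord (Sum.inr x) =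
        ∑ x ∈ σ.toRight \ ρ, p.1.coord (Sum.inr x) := by
      refine Finset.sum_subset (Finset.sdiff_subset_sdiff (toRight_support_subset p) subset_rfl)
        fun x hx hx' => ?_
      by_contra h0
      exact hx' (Finset.mem_sdiff.2 ⟨Finset.mem_toRight.2 (Finsupp.mem_support_iff.2 h0),
        (Finset.mem_sdiff.1 hx).2⟩)
    rw [← hs, subsetWeight]
  simp only [h]
  exact (continuous_finsetProd _ fun x _ => continuous_cell_coord σ _).mul
    (continuous_const.max (continuous_threshold_cell.sub
      (continuous_finsetSum _ fun x _ => continuous_cell_coord σ _)))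

end Continuity

theorem leftWeights_apply (a : Finset X → A) (p : GeomRealization K) (v : A) :
    leftWeights a p v = p.coord (Sum.inl v) +
      ∑ ρ ∈ p.coord.support.toRight.powerset, Finsupp.single (a ρ) (subsetWeight p ρ) v := by
  rw [leftWeights, Finsupp.add_apply, Finsupp.finsetSum_apply, Finsupp.comapDomain_apply]

theorem single_subsetWeight_nonneg (a : Finset X → A) (p : GeomRealization K) (ρ : Finset X)
    (v : A) : 0 ≤ Finsupp.single (a ρ) (subsetWeight p ρ) v := by
  classical
  rw [Finsupp.single_apply]
  split_ifs
  exacts [subsetWeight_nonneg p ρ, le_rfl]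

theorem coord_inl_le_leftWeights (a : Finset X → A) (p : GeomRealization K) (v : A) :
    p.coord (Sum.inl v) ≤ leftWeights a p v := by
  rw [leftWeights_apply]
  exact le_add_of_nonneg_right (Finset.sum_nonneg fun ρ _ => single_subsetWeight_nonneg a p ρ v)

theorem leftWeights_nonneg (a : Finset X → A) (p : GeomRealization K) (v : A) :
    0 ≤ leftWeights a p v :=
  (p.nonneg _).trans (coord_inl_le_leftWeights a p v)

theorem subsetWeight_le_leftWeights (a : Finset X → A) (p : GeomRealization K) {ρ : Finset X}
    (hρ : ρ ⊆ p.coord.support.toRight) : subsetWeight p ρ ≤ leftWeights a p (a ρ) := by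
  rw [leftWeights_apply]
  have h := Finset.single_le_sum
    (f := fun ρ' => Finsupp.single (a ρ') (subsetWeight p ρ') (a ρ))
    (fun ρ' _ => single_subsetWeight_nonneg a p ρ' (a ρ)) (Finset.mem_powerset.2 hρ)
  simp only [Finsupp.single_eq_same] at h
  exact h.trans (le_add_of_nonneg_left (p.nonneg _))

theorem of_leftWeights_ne_zero {a : Finset X → A} {p : GeomRealization K} {v : A}
    (h : leftWeights a p v ≠ 0) :
    p.coord (Sum.inl v) ≠ 0 ∨ ∃ ρ, subsetWeight p ρ ≠ 0 ∧ a ρ = v := by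
  classical
  by_contra! hc
  refine h ?_
  rw [leftWeights_apply, hc.1, zero_add]
  refine Finset.sum_eq_zero fun ρ _ => ?_
  rw [Finsupp.single_apply]
  split_ifs with hv
  · by_contra h0
    exact hc.2 ρ h0 hv
  · rfl

theorem FinitaryContinuous.leftWeights (a : Finset X → A) :
    FinitaryContinuous (leftWeights (K := K) a) := by
  classical
  refine fun σ => ⟨⟨σ.toLeft ∪ σ.toRight.powerset.image a, fun p v hv => ?_⟩, fun v => ?_⟩
  · rw [Finset.mem_union]
    rcases of_leftWeights_ne_zero (Finsupp.mem_support_iff.1 hv) with h | ⟨ρ, h, rfl⟩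
    · exact Or.inl (Finset.mem_toLeft.2 (p.2 (Finsupp.mem_support_iff.2 h)))
    · exact Or.inr (Finset.mem_image_of_mem a (Finset.mem_powerset.2
        ((subset_of_subsetWeight_ne_zero h).trans (toRight_support_subset p))))
  · have h (p : Cell K σ) : GeomRealization.leftWeights a p.1 v = p.1.coord (Sum.inl v) +
        ∑ ρ ∈ σ.toRight.powerset, Finsupp.single (a ρ) (subsetWeight p.1 ρ) v := by
      -- Sets `ρ` outside the support of `p` have weight zero, so the sum may range over a powerset
      -- independent of `p`.
      rw [leftWeights_apply, Finset.sum_subset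
        (Finset.powerset_mono.2 (toRight_support_subset p))]
      intro ρ _ hρ
      have h0 : subsetWeight p.1 ρ = 0 := by
        by_contra h0
        exact hρ (Finset.mem_powerset.2 (subset_of_subsetWeight_ne_zero h0))
      rw [h0, Finsupp.single_zero, Finsupp.zero_apply]
    simp only [h, Finsupp.single_apply]
    refine (continuous_cell_coord σ _).add (continuous_finsetSum _ fun ρ _ => ?_)
    split_ifs
    exacts [continuous_subsetWeight_cell ρ, continuous_const]

theorem FinitaryContinuous.truncatedWeights :
    FinitaryContinuous (truncatedWeights (K := K)) := by
  refine fun σ => ⟨⟨σ, fun p => Finsupp.support_onFinset_subset.trans p.2⟩, ?_⟩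
  rintro (v | x)
  · exact continuous_cell_coord σ _
  · exact continuous_const.max ((continuous_cell_coord σ _).sub continuous_threshold_cell)

theorem truncatedWeights_nonneg (p : GeomRealization K) (v : A ⊕ X) :
    0 ≤ truncatedWeights p v := by
  cases v
  exacts [p.nonneg _, le_max_left _ _]

theorem support_truncatedWeights_subset (p : GeomRealization K) :
    (truncatedWeights p).support ⊆ p.coord.support :=
  Finsupp.support_onFinset_subset

theorem threshold_lt_of_inr_mem_support {p : GeomRealization K} {x : X}
    (h : Sum.inr x ∈ (truncatedWeights p).support) : threshold p < p.coord (Sum.inr x) := by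
  by_contra! hc
  exact Finsupp.mem_support_iff.1 h (max_eq_left (sub_nonpos.2 hc))

theorem exists_inl_of_toRight_support_eq_empty {p : GeomRealization K}
    (h : ¬ p.coord.support.toRight.Nonempty) : ∃ a, Sum.inl a ∈ p.coord.support := by
  obtain ⟨a | x, hv⟩ := (K.isRelLowerSet_faces p.support_mem).1
  · exact ⟨a, hv⟩
  · exact (h ⟨x, Finset.mem_toRight.2 hv⟩).elim

theorem support_truncatedWeights_mem (p : GeomRealization K) :
    (truncatedWeights p).support ∈ K.faces := by
  refine (K.isRelLowerSet_faces p.support_mem).2 (support_truncatedWeights_subset p) ?_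
  by_cases h : p.coord.support.toRight.Nonempty
  · obtain ⟨x, hx⟩ := exists_threshold_lt h
    exact ⟨Sum.inr x, Finsupp.mem_support_iff.2 (lt_max_of_lt_right (sub_pos.2 hx)).ne'⟩
  · obtain ⟨a, ha⟩ := exists_inl_of_toRight_support_eq_empty h
    exact ⟨Sum.inl a, Finsupp.mem_support_iff.2
      (show p.coord (Sum.inl a) ≠ 0 from Finsupp.mem_support_iff.1 ha)⟩

end Retraction

/-! ### The homotopy equivalence for the Dowker join. -/

section Dowker

variable {A : Type u} {X : Type v} {R : SetRel A X} {a : Finset X → A}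

/-- Either `v` is a left vertex of `p`, related to all right vertices of `p`, or `v = a ρ` with `ρ`
of nonzero weight, and then `x ∈ ρ`. -/
theorem mem_of_leftWeights_ne_zero
    (ha : ∀ ρ ∈ (dowkerComplex R.inv).faces, ∀ x ∈ ρ, (a ρ, x) ∈ R)
    {p : GeomRealization (dowkerJoin R)} {v : A} (hv : leftWeights a p v ≠ 0) {x : X}
    (hx : threshold p < p.coord (Sum.inr x)) : (v, x) ∈ R := by
  obtain ⟨-, hp, -, b, hb⟩ := mem_faces_dowkerJoin.1 p.support_mem
  rcases of_leftWeights_ne_zero hv with h | ⟨ρ, h, rfl⟩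
  · exact hp v x (Finsupp.mem_support_iff.2 h)
      (Finsupp.mem_support_iff.2 ((threshold_nonneg p).trans_lt hx).ne')
  · have hxρ := mem_of_subsetWeight_ne_zero h hx
    exact ha ρ ⟨⟨x, hxρ⟩, b, fun y hy =>
      hb y (Finset.mem_toRight.1 (subset_of_subsetWeight_ne_zero h hy))⟩ x hxρ

theorem support_leftWeights_mem
    (ha : ∀ ρ ∈ (dowkerComplex R.inv).faces, ∀ x ∈ ρ, (a ρ, x) ∈ R)
    (p : GeomRealization (dowkerJoin R)) :
    (leftWeights a p).support ∈ (dowkerComplex R).faces := by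
  by_cases h : p.coord.support.toRight.Nonempty
  · obtain ⟨x, hx⟩ := exists_threshold_lt h
    exact ⟨⟨a _, Finsupp.mem_support_iff.2 ((subsetWeight_support_pos h).trans_le
      (subsetWeight_le_leftWeights a p subset_rfl)).ne'⟩, x, fun v hv =>
        mem_of_leftWeights_ne_zero ha (Finsupp.mem_support_iff.1 hv) hx⟩
  · obtain ⟨b, hb⟩ := exists_inl_of_toRight_support_eq_empty h
    obtain ⟨-, -, ⟨x, hx⟩, -⟩ := mem_faces_dowkerJoin.1 p.support_mem
    refine ⟨⟨b, Finsupp.mem_support_iff.2 (((p.nonneg _).lt_of_ne'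
      (Finsupp.mem_support_iff.1 hb)).trans_le (coord_inl_le_leftWeights a p b)).ne'⟩, x,
      fun v hv => ?_⟩
    rcases of_leftWeights_ne_zero (Finsupp.mem_support_iff.1 hv) with h' | ⟨ρ, h', rfl⟩
    · exact hx v (Finsupp.mem_support_iff.2 h')
    -- Without right vertices the threshold vanishes, so no `ρ`, not even the empty set, has
    -- positive weight.
    · have h0 : threshold p = 0 := by
        rw [threshold, Finset.not_nonempty_iff_eq_empty.1 h, Finset.sum_empty, zero_div]
      refine (h' ?_).elim
      rw [subsetWeight, h0, max_eq_left, mul_zero]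
      exact sub_nonpos.2 (Finset.sum_nonneg fun _ _ => p.nonneg _)

theorem map_inl_mem_faces_dowkerJoin : ∀ σ ∈ (dowkerComplex R).faces,
    σ.map Function.Embedding.inl ∈ (dowkerJoin R).faces :=
  fun σ hσ => Or.inl (Or.inl ⟨σ, hσ, rfl⟩)

theorem leftWeights_mapEmb_inl (p : GeomRealization (dowkerComplex R)) :
    leftWeights a (mapEmb Function.Embedding.inl map_inl_mem_faces_dowkerJoin p) = p.coord := by
  have h : (mapEmb Function.Embedding.inl
      (map_inl_mem_faces_dowkerJoin (R := R)) p).coord.support.toRight = ∅ := by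
    ext x
    simp [mapEmb, Finset.mem_toRight]
  ext v
  have h0 : subsetWeight (mapEmb Function.Embedding.inl
      (map_inl_mem_faces_dowkerJoin (R := R)) p) ∅ = 0 := by
    simp [subsetWeight, threshold, h]
  rw [leftWeights_apply, h, Finset.powerset_empty, Finset.sum_singleton, h0, Finsupp.single_zero,
    Finsupp.zero_apply, add_zero]
  exact Finsupp.embDomain_apply_self Function.Embedding.inl p.coord v

theorem nonempty_homotopyEquiv_dowkerJoin (R : SetRel A X) :
    Nonempty (ContinuousMap.HomotopyEquiv
      (GeomRealization (dowkerComplex R)) (GeomRealization (dowkerJoin R))) := by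
  classical
  -- With `A` empty there is nothing to choose `a ρ` from, but both realizations are empty, since a
  -- right simplex needs a witness in `A`.
  rcases isEmpty_or_nonempty A with hA | hA
  · have : IsEmpty (GeomRealization (dowkerComplex R)) :=
      ⟨fun p => hA.elim p.support_mem.1.choose⟩
    have : IsEmpty (GeomRealization (dowkerJoin R)) :=
      ⟨fun p => hA.elim (mem_faces_dowkerJoin.1 p.support_mem).2.2.2.choose⟩
    exact ⟨Homeomorph.empty.toHomotopyEquiv⟩
  have hex (ρ : Finset X) :
      ∃ a : A, ρ ∈ (dowkerComplex R.inv).faces → ∀ x ∈ ρ, (a, x) ∈ R := by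
    by_cases hρ : ρ ∈ (dowkerComplex R.inv).faces
    · obtain ⟨a, h⟩ := hρ.2
      exact ⟨a, fun _ => h⟩
    -- An arbitrary value where `ρ` is not a simplex.
    · exact ⟨hA.some, fun h => (hρ h).elim⟩
  choose a ha using hex
  have hi := FinitaryContinuous.mapEmb Function.Embedding.inl
    (map_inl_mem_faces_dowkerJoin (R := R))
  have hr := (FinitaryContinuous.leftWeights a).ofWeights
    (leftWeights_nonneg a) (support_leftWeights_mem ha)
  have ht := (FinitaryContinuous.truncatedWeights (K := dowkerJoin R)).ofWeights
    truncatedWeights_nonneg support_truncatedWeights_mem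
  let i : C(GeomRealization (dowkerComplex R), GeomRealization (dowkerJoin R)) :=
    ⟨_, hi.continuous⟩
  let r : C(GeomRealization (dowkerJoin R), GeomRealization (dowkerComplex R)) :=
    ⟨_, hr.continuous⟩
  let t : C(GeomRealization (dowkerJoin R), GeomRealization (dowkerJoin R)) :=
    ⟨_, ht.continuous⟩
  have hri : r.comp i = ContinuousMap.id _ :=
    ContinuousMap.ext fun p => ofWeights_eq (leftWeights_nonneg a _)
      (support_leftWeights_mem ha _) (leftWeights_mapEmb_inl p)
  have hts (p) : (t p).coord.support = (truncatedWeights p).support :=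
    support_ofWeights (truncatedWeights_nonneg p) (support_truncatedWeights_mem p)
  have hirs (p) : (i (r p)).coord.support =
      (leftWeights a p).support.map Function.Embedding.inl :=
    (Finsupp.support_embDomain _ _).trans (congrArg _
      (support_ofWeights (leftWeights_nonneg a p) (support_leftWeights_mem ha p)))
  have hit : (i.comp r).Homotopic t := by
    refine homotopic_of_support_union_mem (hi.comp hr) ht fun p => ?_
    rw [ContinuousMap.comp_apply, hts, hirs]
    have hl : ∀ v, Sum.inl v ∈ (leftWeights a p).support.map Function.Embedding.inl ∪
        (truncatedWeights p).support → leftWeights a p v ≠ 0 := by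
      intro v hv
      rcases Finset.mem_union.1 hv with h | h
      · simpa using h
      · exact (((p.nonneg _).lt_of_ne' (Finsupp.mem_support_iff.1
          (support_truncatedWeights_subset p h))).trans_le (coord_inl_le_leftWeights a p v)).ne'
    have hr' : ∀ x, Sum.inr x ∈ (leftWeights a p).support.map Function.Embedding.inl ∪
        (truncatedWeights p).support → Sum.inr x ∈ (truncatedWeights p).support := by
      intro x hx
      simpa using hx
    obtain ⟨hne, -, -, b, hb⟩ := mem_faces_dowkerJoin.1 (support_truncatedWeights_mem p)
    obtain ⟨-, x, hx⟩ := support_leftWeights_mem ha p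
    -- Left vertices of the union belong to `r p`, right ones to `t p`, so the latter are above the
    -- threshold and each cross pair is related.
    exact mem_faces_dowkerJoin.2 ⟨hne.mono Finset.subset_union_right,
      fun v y hv hy => mem_of_leftWeights_ne_zero ha (hl v hv)
        (threshold_lt_of_inr_mem_support (hr' y hy)),
      ⟨x, fun v hv => hx v (Finsupp.mem_support_iff.2 (hl v hv))⟩,
      b, fun y hy => hb y (hr' y hy)⟩
  have htid : t.Homotopic (ContinuousMap.id _) := by
    refine homotopic_of_support_union_mem ht FinitaryContinuous.coord fun p => ?_
    rw [hts, ContinuousMap.id_apply,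
      Finset.union_eq_right.2 (support_truncatedWeights_subset p)]
    exact p.support_mem
  exact ⟨⟨i, r, hri ▸ ContinuousMap.Homotopic.refl _, hit.trans htid⟩⟩

theorem map_sumComm_mem_faces_dowkerJoin (R : SetRel A X) : ∀ s ∈ (dowkerJoin R).faces,
    s.map (Equiv.sumComm A X).toEmbedding ∈ (dowkerJoin R.inv).faces := by
  intro s hs
  obtain ⟨hne, h, hx, ha⟩ := mem_faces_dowkerJoin.1 hs
  refine mem_faces_dowkerJoin.2 ⟨hne.map, ?_, ?_, ?_⟩
  · exact fun x a hx ha => h a x (by simpa using ha) (by simpa using hx)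
  · obtain ⟨a, ha⟩ := ha
    exact ⟨a, fun x hx => ha x (by simpa using hx)⟩
  · obtain ⟨x, hx⟩ := hx
    exact ⟨x, fun a ha => hx a (by simpa using ha)⟩

/-- The Dowker join complexes of a relation and of its inverse have homeomorphic realizations. -/
noncomputable def dowkerJoinInvHomeomorph (R : SetRel A X) :
    GeomRealization (dowkerJoin R) ≃ₜ GeomRealization (dowkerJoin R.inv) :=
  homeomorphOfEquiv (Equiv.sumComm A X) (map_sumComm_mem_faces_dowkerJoin R)
    (map_sumComm_mem_faces_dowkerJoin R.inv)

end Dowker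

end GeomRealization

theorem theorem3p10 {A : Type u} {X : Type v} (R : SetRel A X) :
    Nonempty (ContinuousMap.HomotopyEquiv
      (GeomRealization (dowkerComplex R)) (GeomRealization (dowkerJoin R))) ∧
    Nonempty (ContinuousMap.HomotopyEquiv
      (GeomRealization (dowkerJoin R)) (GeomRealization (dowkerComplex R.inv))) := by
  refine ⟨GeomRealization.nonempty_homotopyEquiv_dowkerJoin R, ?_⟩
  -- The second equivalence is the first one for the inverse relation, after swapping the two sides
  -- of the join.
  obtain ⟨e⟩ := GeomRealization.nonempty_homotopyEquiv_dowkerJoin R.inv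
  exact ⟨(GeomRealization.dowkerJoinInvHomeomorph R).toHomotopyEquiv.trans e.symm⟩
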